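/- Let $k\ge 1$, let $G$ be a finite undirected multigraph that is $k$-edge-connected (any two distinct vertices are joined by $k$ pairwise edge-disjoint paths), and let $d\in V(G)$ be a destination. **Arborescences.** An arc is an edge together with a direction; each edge $\{x,y\}$ gives the arcs $(x,y)$ and $(y,x)$. A $d$-rooted spanning arborescence $T$ is a set of arcs such that no arc of $T$ leaves $d$ and every vertex $v\ne d$ has exactly one directed walk to $d$ along $T$. A depth-first traversal $R(T)$ is a closed walk from $d$ that traverses $T$ depth-first, ignoring orientations (each edge of $T$ once down and once up, the children of each vertex being visited in some order); $R^{-1}(T)$ is the reversed walk. **Routing functions.** A set of header-rewriting routing functions with $b$ bits assigns to each vertex $v$ a function that maps the incoming edge (or the information that the packet originates at $v$), the set of active (non-failed) edges incident to $v$, and $b$ header bits to an outgoing edge and new values of the $b$ bits. It is $c$-resilient (for $d$) if, whenever at most $c$ edges fail, a packet originating with all $b$ bits $0$ at any vertex $v$ that is still connected to $d$ by non-failed edges reaches $d$. **DF-Algo.** Given pairwise arc-disjoint $d$-rooted spanning arborescences $T_1,\dots,T_k$ with traversals $R(T_1),\dots,R(T_k)$, a packet is routed as follows. 1. Set $i:=1$.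 2. Repeat until the packet is at $d$: (a) route along the path of $T_i$ towards $d$ (canonical mode) until $d$ is reached or the next arc $a=(x,y)$ lies on a failed edge; (b) in the latter case, if $(y,x)$ belongs to some $T_j$, bounce: follow $R(T_j)$ from the arc following $(y,x)$ on, until $d$ is reached or the next arc lies on a failed edge; in that case go back to $x$ along $R^{-1}(T_j)$, until the next arc is $a$; (c) replace $i$ by its cyclic successor ($i+1$ if $i<k$, and $1$ if $i=k$) and continue from $x$. DF-Algo is implemented with three header bits: two bits $RM$ store the mode (canonical, along $R$, along $R^{-1}$), and one bit $H$ tells whether, of the at most two arborescences that use the edge over which the packet is sent, the packet is routed along the one of higher index ($H=1$; also when only one arborescence uses the edge) or of lower index ($H=0$). In canonical mode the arborescence is the one containing the last arc traversed; in the other modes it is determined by $H$ and the last edge traversed. At a vertex, the packet is sent over the first edge proposed by the above procedure that is active. **Theorem.** There exist $k$ pairwise arc-disjoint $d$-rooted spanning arborescences $T_1,\dots,T_k$ of $G$ and depth-first traversals of them. For every choice of such $T_1,\dots,T_k$ and of depth-first traversals $R(T_1),\dots,R(T_k)$, the header-rewriting routing functions with three bits computed by DF-Algo are $(k-1)$-resilient.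 -/

import Mathlib

namespace FailoverRouting

variable {α β : Type*}

/-! ### Multigraphs, directed copies, paths -/

/-- An arc of the directed copy of a multigraph: an edge together with a direction. -/
@[ext]
structure Arc (α β : Type*) where
  edge : β
  src : α
  tgt : α

/-- The opposite arc on the same edge. -/
def Arc.rev (a : Arc α β) : Arc α β := ⟨a.edge, a.tgt, a.src⟩

/-- The arcs of the directed copy of `G`: every edge `{x, y}` yields the arcs `(x, y)`, `(y, x)`. -/
def arcs (G : Graph α β) : Set (Arc α β) := {a | G.IsLink a.edge a.src a.tgt}

/-- `IsWalk A u p v`: the list of arcs `p` is a directed walk from `u` to `v` all of whose arcs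
lie in `A`. -/
def IsWalk (A : Set (Arc α β)) : α → List (Arc α β) → α → Prop
  | u, [], v => u = v
  | u, a :: p, v => a ∈ A ∧ a.src = u ∧ IsWalk A a.tgt p v

/-- A walk without repeated vertices. -/
def IsPath (A : Set (Arc α β)) (u : α) (p : List (Arc α β)) (v : α) : Prop :=
  IsWalk A u p v ∧ (u :: p.map Arc.tgt).Nodup

/-- There are `k` pairwise edge-disjoint paths between any two distinct vertices of `G`. -/
def IsEdgeConnected (G : Graph α β) (k : ℕ) : Prop :=
  ∀ u ∈ G.vertexSet, ∀ v ∈ G.vertexSet, u ≠ v →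
    ∃ P : Fin k → List (Arc α β), (∀ i, IsPath (arcs G) u (P i) v) ∧
      ∀ i j, i ≠ j → ∀ a ∈ P i, ∀ b ∈ P j, a.edge ≠ b.edge

/-! ### Header-rewriting routing and resilience -/

/-- A set of header-rewriting routing functions with `b` rewritable header bits, one function for
each vertex. The function at a vertex receives only local information: the incoming edge (`none`
if the packet originates at the vertex), the set of active edges incident to the vertex, and the
header bits. It returns the outgoing edge and the new header bits (`none`: the packet is
dropped). -/
def HeaderRouting (α β : Type*) (b : ℕ) : Type _ :=
  α → Option β → Set β → (Fin b → Bool) → Option (β × (Fin b → Bool))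

/-- The active edges incident to `v` when the edges in `F` have failed. -/
def activeEdges (G : Graph α β) (F : Set β) (v : α) : Set β := {e | G.Inc e v ∧ e ∉ F}

/-- The state of a packet in the network: its current vertex, the edge along which it arrived
there, and its header bits. -/
structure Packet (α β : Type*) (b : ℕ) where
  pos : α
  inc : Option β
  header : Fin b → Bool

/-- One hop of a packet that has not yet reached the destination `d`, when the edges in `F` have
failed. -/
def Hop {b : ℕ} (G : Graph α β) (d : α) (f : HeaderRouting α β b) (F : Set β)
    (p q : Packet α β b) : Prop :=
  p.pos ≠ d ∧ ∃ e ∈ activeEdges G F p.pos,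
    f p.pos p.inc (activeEdges G F p.pos) p.header = some (e, q.header) ∧
      G.IsLink e p.pos q.pos ∧ q.inc = some e

/-- A packet that originates at `v`, with all header bits `0`, reaches `d`. -/
def Delivers {b : ℕ} (G : Graph α β) (d : α) (f : HeaderRouting α β b) (F : Set β) (v : α) :
    Prop :=
  ∃ q : Packet α β b, q.pos = d ∧ Relation.ReflTransGen (Hop G d f F) ⟨v, none, fun _ => false⟩ q

/-- `f` is `c`-resilient: whenever at most `c` edges fail, a packet originating at any vertex
that is still connected to `d` reaches `d`. -/
def IsResilient {b : ℕ} (G : Graph α β) (d : α) (f : HeaderRouting α β b) (c : ℕ) : Prop :=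
  ∀ F ⊆ G.edgeSet, F.encard ≤ c → ∀ v ∈ G.vertexSet,
    (∃ p, IsPath (arcs (G.deleteEdges F)) v p d) → Delivers G d f F v

/-! ### Arborescences and their depth-first traversals -/

/-- `T` is (the arc set of) a `d`-rooted spanning arborescence of the directed copy of `G`: no arc
leaves `d`, and from every other vertex there is exactly one directed walk to `d` along `T`. -/
structure IsSpanningArborescence (G : Graph α β) (d : α) (T : Set (Arc α β)) : Prop where
  root_mem : d ∈ G.vertexSet
  subset_arcs : T ⊆ arcs G
  root_out : ∀ a ∈ T, a.src ≠ d
  existsUnique_walk : ∀ v ∈ G.vertexSet, v ≠ d → ∃! p, IsWalk T v p d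

/-- `cs` enumerates the arcs from the children of `x` in `T` to `x`, each exactly once. -/
def IsChildOrder (T : Set (Arc α β)) (x : α) (cs : List (Arc α β)) : Prop :=
  cs.Nodup ∧ ∀ a, a ∈ cs ↔ a ∈ T ∧ a.tgt = x

/-- `IsTour T x cs w`: the walk `w` starts and ends at `x` and traverses, in depth-first manner,
one after the other, the subtrees of `T` hanging at `x` by the arcs in the list `cs`. The subtree
hanging by `a` is traversed by going down `a.rev`, traversing all subtrees hanging at `a.src`
in some order, and going up `a`. -/
inductive IsTour (T : Set (Arc α β)) : α → List (Arc α β) → List (Arc α β) → Prop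
  | nil (x : α) : IsTour T x [] []
  | cons {x : α} {a : Arc α β} {cs us w w' : List (Arc α β)} :
      a ∈ T → a.tgt = x → IsChildOrder T a.src us → IsTour T a.src us w → IsTour T x cs w' →
      IsTour T x (a :: cs) (a.rev :: (w ++ a :: w'))

/-- `R` is a depth-first traversal of the whole of `T` from `d` (ignoring orientations). -/
def IsDFSTraversal (T : Set (Arc α β)) (d : α) (R : List (Arc α β)) : Prop :=
  ∃ cs, IsChildOrder T d cs ∧ IsTour T d cs R

/-- The reversed walk. -/
def inverseTraversal (R : List (Arc α β)) : List (Arc α β) := (R.map Arc.rev).reverse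

/-- What the routing algorithm is given: `k` pairwise arc-disjoint `d`-rooted spanning
arborescences, and a depth-first traversal of each of them. -/
structure IsDFInput (G : Graph α β) (d : α) {k : ℕ} (T : Fin k → Set (Arc α β))
    (R : Fin k → List (Arc α β)) : Prop where
  arborescence : ∀ i, IsSpanningArborescence G d (T i)
  arcDisjoint : ∀ i j, i ≠ j → Disjoint (T i) (T j)
  traversal : ∀ i, IsDFSTraversal (T i) d (R i)

/-! ### The routing algorithm -/

/-- The routing mode: canonical, along a traversal, or along an inverse traversal. -/
inductive Mode where
  | canonical
  | traverse
  | backtrack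

/-- Two header bits hold the mode (`00`, `01`, `10`), the third one holds `H`. -/
def encode : Mode → Bool → (Fin 3 → Bool)
  | .canonical, H => ![false, false, H]
  | .traverse, H => ![false, true, H]
  | .backtrack, H => ![true, false, H]

/-- The mode stored in a header (`11` is not used). -/
def decodeMode (h : Fin 3 → Bool) : Mode :=
  if h 0 then .backtrack else if h 1 then .traverse else .canonical

/-- The bit `H` stored in a header. -/
def decodeH (h : Fin 3 → Bool) : Bool := h 2

section Algorithm

open Classical

/-- The first arc following `a` in a list of arcs. -/
noncomputable def nextArcIn (a : Arc α β) : List (Arc α β) → Option (Arc α β)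
  | x :: y :: l => if x = a then some y else nextArcIn a (y :: l)
  | _ => none

/-- The arc of `T` that leaves `x`, i.e. the first arc on the path from `x` to the root. -/
noncomputable def outArc (T : Set (Arc α β)) (x : α) : Option (Arc α β) :=
  if h : ∃ a ∈ T, a.src = x then some h.choose else none

variable {k : ℕ} [NeZero k]

/-- The indices of the (one or two) arborescences that contain an arc on the edge `e`. -/
noncomputable def treeIndices (T : Fin k → Set (Arc α β)) (e : β) : Finset (Fin k) :=
  Finset.univ.filter fun i => ∃ a ∈ T i, a.edge = e

/-- The arborescence on the edge `e` that the bit `H` stands for: the one of higher index if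
`H = 1`, the one of lower index if `H = 0`. -/
noncomputable def treeIndexGivenH (T : Fin k → Set (Arc α β)) (H : Bool) (e : β) : Fin k :=
  if h : (treeIndices T e).Nonempty then
    if H then (treeIndices T e).max' h else (treeIndices T e).min' h
  else 0

/-- The value of `H` that stands for the arborescence `T i` on the edge `e`. -/
noncomputable def hGivenTreeIndex (T : Fin k → Set (Arc α β)) (i : Fin k) (e : β) : Bool :=
  decide (i = treeIndexGivenH T true e)

/-- The index of the arborescence that contains the arc `a`. -/
noncomputable def treeIndexOfArc (T : Fin k → Set (Arc α β)) (a : Arc α β) : Fin k :=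
  if h : ∃ i, a ∈ T i then h.choose else 0

/-- The index of the arborescence used by a packet that is routed along the arc `a` in mode `m`
with bit `H`. -/
noncomputable def treeIndex (T : Fin k → Set (Arc α β)) : Mode → Bool → Arc α β → Fin k
  | .canonical, _, a => treeIndexOfArc T a
  | .traverse, H, a => treeIndexGivenH T H a.edge
  | .backtrack, H, a => treeIndexGivenH T H a.edge

/-- The arc to be used after the arc `a` when routing along `T i` in the given mode. -/
noncomputable def nextArc (T : Fin k → Set (Arc α β)) (R : Fin k → List (Arc α β)) :
    Mode → Arc α β → Fin k → Option (Arc α β)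
  | .canonical, a, i => outArc (T i) a.tgt
  | .traverse, a, i => nextArcIn a (R i)
  | .backtrack, a, i => nextArcIn a (inverseTraversal (R i))

/-- A forwarding decision at a vertex `a.src`: send the packet along the arc `a`, with mode `m`
and bit `H` in its header. -/
structure Attempt (α β : Type*) where
  mode : Mode
  H : Bool
  arc : Arc α β

/-- The decision to use the arc `a?` (if there is one) along `T i` in mode `m`, with the
corresponding bit `H`. -/
noncomputable def mkAttempt (T : Fin k → Set (Arc α β)) (m : Mode) (i : Fin k)
    (a? : Option (Arc α β)) : Option (Attempt α β) :=
  a?.map fun a => ⟨m, hGivenTreeIndex T i a.edge, a⟩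

/-- The first decision about a packet at the vertex `v`. A packet that originates at `v` is routed
canonically along the first arborescence. A packet that arrived along the edge `e` continues
along the same arborescence in the same mode. -/
noncomputable def firstAttempt (G : Graph α β) (T : Fin k → Set (Arc α β))
    (R : Fin k → List (Arc α β)) (v : α) (inc : Option β) (h : Fin 3 → Bool) :
    Option (Attempt α β) :=
  match inc with
  | none => mkAttempt T .canonical 0 (outArc (T 0) v)
  | some e =>
    if hu : ∃ u, G.IsLink e u v then
      let a : Arc α β := ⟨e, hu.choose, v⟩
      let i := treeIndex T (decodeMode h) (decodeH h) a
      mkAttempt T (decodeMode h) i (nextArc T R (decodeMode h) a i)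
    else none

/-- The new decision at the vertex `t.arc.src` if the edge of the previous decision `t` has failed.
* Canonical mode, along `T i`: if the edge is shared with another arborescence `T j`, bounce, i.e.
  follow the traversal of `T j` from the reversed arc on; otherwise, pass to backtracking mode on
  the same arc (which makes the next decision switch to the next arborescence).
* Traversal of `T i`: backtrack along the inverse traversal of `T i`.
* Backtracking: the packet is back at the edge on which it bounced; switch to the arborescence
  following, in circular order, the one that contains this arc, in canonical mode. -/
noncomputable def retry (T : Fin k → Set (Arc α β)) (R : Fin k → List (Arc α β))
    (t : Attempt α β) : Option (Attempt α β) :=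
  let i := treeIndex T t.mode t.H t.arc
  match t.mode with
  | .canonical =>
    let j := treeIndexGivenH T (!t.H) t.arc.edge
    if j ≠ i then mkAttempt T .traverse j (nextArc T R .traverse t.arc.rev j)
    else some ⟨.backtrack, false, t.arc⟩
  | .traverse => mkAttempt T .backtrack i (nextArc T R .backtrack t.arc.rev i)
  | .backtrack =>
    let j := treeIndex T .canonical false t.arc + 1
    mkAttempt T .canonical j (outArc (T j) t.arc.src)

/-- The `n`-th decision about a packet at the vertex `v`. -/
noncomputable def attempt (G : Graph α β) (T : Fin k → Set (Arc α β))
    (R : Fin k → List (Arc α β)) (v : α) (inc : Option β) (h : Fin 3 → Bool) :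
    ℕ → Option (Attempt α β)
  | 0 => firstAttempt G T R v inc h
  | n + 1 => (attempt G T R v inc h n).bind (retry T R)

/-- `DF-Algo`: forward the packet according to the first decision whose edge is active. -/
noncomputable def dfAlgo (G : Graph α β) (T : Fin k → Set (Arc α β))
    (R : Fin k → List (Arc α β)) : HeaderRouting α β 3 := fun v inc A h =>
  if hn : ∃ n, ∃ t ∈ attempt G T R v inc h n, t.arc.edge ∈ A then
    (attempt G T R v inc h (Nat.find hn)).map fun t => (t.arc.edge, encode t.mode t.H)
  else none

end Algorithm

end FailoverRouting

open FailoverRouting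

namespace FailoverRouting

variable {α β : Type*}

/-! ### Arcs and walks -/

/-! Existence of the input: each of `k` edge-disjoint paths to `d` from a vertex of a set avoiding
`d` crosses the boundary of that set, so at least `k` arcs leave it. Edmonds' theorem then gives the
arborescences. As in Lovász's proof, one arborescence is grown arc by arc without lowering any cut
of the remaining arcs below `k - 1`; submodularity supplies the next arc
(`IsArborescenceOn.exists_extension`). It is then peeled off.

Resilience is a counting argument. Call `T g` good if bouncing on any of its failed arcs leads to
`d`. If no arborescence is good, each `T i` has a failed arc `a i` on which bouncing does not lead
to `d`. Each `R j` has a last failed arc `b j`, which is an ascent, hence in `T j`, because edges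
are descended before they are ascended. Arc-disjointness makes the `a i` distinct, and likewise the
`(b j).rev`. Moreover `a i = (b j).rev` is impossible, since bouncing on `a i` would then follow `R
j` after its last failure. So `2 * k` arcs lie on at most `k - 1` failed edges, which carry two arcs
each, a contradiction (`exists_good_index`).

An arborescence that is not good does no harm: an unsuccessful bounce is retraced to the failed arc,
and the next arborescence takes over (`succeeds_canonical_of_next`). A good one is thus reached from
the first without wrapping around, unless the packet arrives earlier. Three header bits suffice
because an edge carries only two arcs, so `H` and the edge identify the arborescence
(`treeIndexGivenH_hGivenTreeIndex`). -/

@[simp] theorem Arc.rev_rev (a : Arc α β) : a.rev.rev = a := rfl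

@[simp] theorem Arc.rev_edge (a : Arc α β) : a.rev.edge = a.edge := rfl

@[simp] theorem Arc.rev_src (a : Arc α β) : a.rev.src = a.tgt := rfl

@[simp] theorem Arc.rev_tgt (a : Arc α β) : a.rev.tgt = a.src := rfl

theorem Arc.rev_injective : Function.Injective (Arc.rev : Arc α β → Arc α β) :=
  Function.LeftInverse.injective Arc.rev_rev

theorem rev_mem_arcs {G : Graph α β} {a : Arc α β} (h : a ∈ arcs G) : a.rev ∈ arcs G :=
  Graph.IsLink.symm h

theorem src_mem_of_mem_arcs {G : Graph α β} {a : Arc α β} (h : a ∈ arcs G) :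
    a.src ∈ G.vertexSet :=
  Graph.IsLink.left_mem h

theorem tgt_mem_of_mem_arcs {G : Graph α β} {a : Arc α β} (h : a ∈ arcs G) :
    a.tgt ∈ G.vertexSet :=
  Graph.IsLink.right_mem h

theorem edge_mem_of_mem_arcs {G : Graph α β} {a : Arc α β} (h : a ∈ arcs G) :
    a.edge ∈ G.edgeSet :=
  Graph.IsLink.edge_mem h

/-- There are only two arcs on an edge. -/
theorem eq_or_eq_rev_of_edge_eq {G : Graph α β} {a b : Arc α β} (ha : a ∈ arcs G)
    (hb : b ∈ arcs G) (h : a.edge = b.edge) : a = b ∨ a = b.rev := by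
  have hb' : G.IsLink a.edge b.src b.tgt := h ▸ hb
  rcases Graph.IsLink.eq_and_eq_or_eq_and_eq ha hb' with ⟨h1, h2⟩ | ⟨h1, h2⟩
  · exact .inl (Arc.ext h h1 h2)
  · exact .inr (Arc.ext h h1 h2)

theorem arcs_finite {G : Graph α β} (hV : G.vertexSet.Finite) (hE : G.edgeSet.Finite) :
    (arcs G).Finite := by
  refine ((hE.prod (hV.prod hV)).image fun x => (⟨x.1, x.2.1, x.2.2⟩ : Arc α β)).subset ?_
  intro a ha
  exact ⟨(a.edge, a.src, a.tgt), ⟨edge_mem_of_mem_arcs ha, src_mem_of_mem_arcs ha,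
    tgt_mem_of_mem_arcs ha⟩, rfl⟩

theorem IsWalk.mono {A B : Set (Arc α β)} (h : A ⊆ B) {p : List (Arc α β)} {u v : α}
    (hp : IsWalk A u p v) : IsWalk B u p v := by
  induction p generalizing u with
  | nil => exact hp
  | cons a p ih => exact ⟨h hp.1, hp.2.1, ih hp.2.2⟩

theorem isWalk_append {A : Set (Arc α β)} {p q : List (Arc α β)} {u w : α} :
    IsWalk A u (p ++ q) w ↔ ∃ v, IsWalk A u p v ∧ IsWalk A v q w := by
  induction p generalizing u with
  | nil => simp [IsWalk]
  | cons a p ih => simp [IsWalk, ih, and_assoc]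

theorem IsWalk.append {A : Set (Arc α β)} {p q : List (Arc α β)} {u v w : α}
    (hp : IsWalk A u p v) (hq : IsWalk A v q w) : IsWalk A u (p ++ q) w :=
  isWalk_append.2 ⟨v, hp, hq⟩

theorem IsWalk.mem {A : Set (Arc α β)} {p : List (Arc α β)} {u v : α}
    (hp : IsWalk A u p v) : ∀ a ∈ p, a ∈ A := by
  induction p generalizing u with
  | nil => simp
  | cons a p ih =>
    simp only [List.mem_cons, forall_eq_or_imp]
    exact ⟨hp.1, ih hp.2.2⟩

theorem isWalk_singleton {A : Set (Arc α β)} {a : Arc α β} (h : a ∈ A) :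
    IsWalk A a.src [a] a.tgt :=
  ⟨h, rfl, rfl⟩

/-- A walk from inside `X` to outside `X` uses an arc that leaves `X`. -/
theorem IsWalk.exists_leaving {A : Set (Arc α β)} {X : Set α} {p : List (Arc α β)} {u v : α}
    (hp : IsWalk A u p v) (hu : u ∈ X) (hv : v ∉ X) : ∃ a ∈ p, a.src ∈ X ∧ a.tgt ∉ X := by
  induction p generalizing u with
  | nil => exact absurd (hp ▸ hu) hv
  | cons a p ih =>
    obtain ⟨-, rfl, hp⟩ := hp
    by_cases h : a.tgt ∈ X
    · obtain ⟨b, hb, hb'⟩ := ih hp h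
      exact ⟨b, List.mem_cons_of_mem _ hb, hb'⟩
    · exact ⟨a, List.mem_cons_self, hu, h⟩

/-! ### Spanning arborescences -/

/-- If every vertex has at most one outgoing arc and `d` has none, walks to `d` are unique. -/
theorem IsWalk.unique_of_functional {A : Set (Arc α β)} {d : α} (hd : ∀ a ∈ A, a.src ≠ d)
    (hA : ∀ a ∈ A, ∀ b ∈ A, a.src = b.src → a = b) {p q : List (Arc α β)} {u : α}
    (hp : IsWalk A u p d) (hq : IsWalk A u q d) : p = q := by
  induction p generalizing u q with
  | nil =>
    cases q with
    | nil => rfl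
    | cons b q =>
      obtain rfl : u = d := hp
      exact absurd hq.2.1 (hd b hq.1)
  | cons a p ih =>
    cases q with
    | nil =>
      obtain rfl : u = d := hq
      exact absurd hp.2.1 (hd a hp.1)
    | cons b q =>
      obtain rfl := hA a hp.1 b hq.1 (hp.2.1.trans hq.2.1.symm)
      rw [ih hp.2.2 hq.2.2]

namespace IsSpanningArborescence

variable {G : Graph α β} {d : α} {T : Set (Arc α β)} (hT : IsSpanningArborescence G d T)
include hT

theorem exists_walk {v : α} (hv : v ∈ G.vertexSet) : ∃ p, IsWalk T v p d := by
  by_cases h : v = d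
  · exact ⟨[], h⟩
  · exact (hT.existsUnique_walk v hv h).exists

/-- Continuing two different such arcs to `d` would give two walks from their common source. -/
theorem eq_of_src_eq {a b : Arc α β} (ha : a ∈ T) (hb : b ∈ T) (h : a.src = b.src) : a = b := by
  obtain ⟨p, hp⟩ := hT.exists_walk (tgt_mem_of_mem_arcs (hT.subset_arcs ha))
  obtain ⟨q, hq⟩ := hT.exists_walk (tgt_mem_of_mem_arcs (hT.subset_arcs hb))
  have := (hT.existsUnique_walk a.src (src_mem_of_mem_arcs (hT.subset_arcs ha))
    (hT.root_out a ha)).unique (y₁ := a :: p) (y₂ := b :: q) ⟨ha, rfl, hp⟩ ⟨hb, h.symm, hq⟩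
  exact (List.cons.inj this).1

theorem walk_unique {u : α} {p q : List (Arc α β)} (hp : IsWalk T u p d) (hq : IsWalk T u q d) :
    p = q :=
  hp.unique_of_functional hT.root_out (fun _ ha _ hb => hT.eq_of_src_eq ha hb) hq

/-- Otherwise prepending the closed walk to a walk to `d` would give a second one. -/
theorem eq_nil_of_closed {v : α} (hv : v ∈ G.vertexSet) {p : List (Arc α β)}
    (hp : IsWalk T v p v) : p = [] := by
  obtain ⟨q, hq⟩ := hT.exists_walk hv
  simpa using hT.walk_unique (hp.append hq) hq

theorem rev_notMem {a : Arc α β} (ha : a ∈ T) : a.rev ∉ T := fun h => by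
  have := hT.eq_nil_of_closed (src_mem_of_mem_arcs (hT.subset_arcs ha))
    (p := [a, a.rev]) ⟨ha, rfl, h, rfl, rfl⟩
  simp at this

theorem exists_out {v : α} (hv : v ∈ G.vertexSet) (hvd : v ≠ d) : ∃ a ∈ T, a.src = v := by
  obtain ⟨p, hp⟩ := hT.exists_walk hv
  cases p with
  | nil => exact absurd hp hvd
  | cons a p => exact ⟨a, hp.1, hp.2.1⟩

/-- The subtrees hanging at different children are disjoint. -/
theorem child_unique {v : α} {c c' : Arc α β} {p q : List (Arc α β)}
    (hp : IsWalk T v p c.src) (hq : IsWalk T v q c'.src) (hc : c ∈ T) (hc' : c' ∈ T)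
    (h : c.tgt = c'.tgt) : c = c' := by
  obtain ⟨r, hr⟩ := hT.exists_walk (tgt_mem_of_mem_arcs (hT.subset_arcs hc))
  have h1 : IsWalk T v (p ++ c :: r) d := hp.append ⟨hc, rfl, hr⟩
  have h2 : IsWalk T v (q ++ c' :: r) d := hq.append ⟨hc', rfl, h ▸ hr⟩
  have := hT.walk_unique h1 h2
  -- Both walks end with `r`, so `p` and `q` have equal length and the arcs following them coincide.
  have hl := congrArg List.length this
  simp only [List.length_append, List.length_cons, Nat.add_right_cancel_iff] at hl
  exact (List.cons.inj (List.append_inj this hl).2).1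

end IsSpanningArborescence

theorem isSpanningArborescence_of_functional {G : Graph α β} {d : α} {T : Set (Arc α β)}
    (hd : d ∈ G.vertexSet) (hTG : T ⊆ arcs G) (hout : ∀ a ∈ T, a.src ≠ d)
    (hT : ∀ a ∈ T, ∀ b ∈ T, a.src = b.src → a = b)
    (hw : ∀ v ∈ G.vertexSet, ∃ p, IsWalk T v p d) : IsSpanningArborescence G d T where
  root_mem := hd
  subset_arcs := hTG
  root_out := hout
  existsUnique_walk v hv _ := by
    obtain ⟨p, hp⟩ := hw v hv
    exact ⟨p, hp, fun q hq => hq.unique_of_functional hout hT hp⟩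

/-! ### Edmonds' disjoint arborescences -/

section Edmonds

open Classical Finset

/-- The number of arcs in `A` that leave `X`. -/
noncomputable def outDegree (A : Finset (Arc α β)) (X : Finset α) : ℕ :=
  #{a ∈ A | a.src ∈ X ∧ a.tgt ∉ X}

/-- Submodularity of the cut function, checked arc by arc. -/
theorem outDegree_inter_add_union_le (A : Finset (Arc α β)) (X Y : Finset α) :
    outDegree A (X ∩ Y) + outDegree A (X ∪ Y) ≤ outDegree A X + outDegree A Y := by
  simp only [outDegree, card_filter, ← sum_add_distrib]
  refine sum_le_sum fun a _ => ?_
  by_cases h1 : a.src ∈ X <;> by_cases h2 : a.src ∈ Y <;> by_cases h3 : a.tgt ∈ X <;>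
    by_cases h4 : a.tgt ∈ Y <;> simp [h1, h2, h3, h4]

theorem outDegree_erase_of_not_leaving {A : Finset (Arc α β)} {X : Finset α} {e : Arc α β}
    (h : ¬(e.src ∈ X ∧ e.tgt ∉ X)) : outDegree (A.erase e) X = outDegree A X := by
  rw [outDegree, outDegree]
  congr 1
  ext a
  simp only [mem_filter, mem_erase]
  constructor
  · rintro ⟨⟨_, h1⟩, h2⟩
    exact ⟨h1, h2⟩
  · rintro ⟨h1, h2⟩
    exact ⟨⟨fun h' => h (h' ▸ h2), h1⟩, h2⟩

theorem outDegree_le_outDegree_erase (A : Finset (Arc α β)) (X : Finset α) (e : Arc α β) :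
    outDegree A X ≤ outDegree (A.erase e) X + 1 := by
  rw [outDegree, outDegree, filter_erase]
  have := pred_card_le_card_erase (s := {a ∈ A | a.src ∈ X ∧ a.tgt ∉ X}) (a := e)
  omega

/-- Every nonempty set of vertices in `V` that avoids `d` is left by at least `k` arcs in `A`. -/
def IsCutBounded (V : Finset α) (d : α) (A : Finset (Arc α β)) (k : ℕ) : Prop :=
  ∀ X ⊆ V, X.Nonempty → d ∉ X → k ≤ outDegree A X

/-- `F` is an arborescence rooted at `d` on the vertex set `U`. -/
structure IsArborescenceOn (U : Finset α) (d : α) (F : Finset (Arc α β)) : Prop where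
  src_ne : ∀ a ∈ F, a.src ≠ d
  src_mem : ∀ a ∈ F, a.src ∈ U
  tgt_mem : ∀ a ∈ F, a.tgt ∈ U
  functional : ∀ a ∈ F, ∀ b ∈ F, a.src = b.src → a = b
  exists_walk : ∀ u ∈ U, ∃ p, IsWalk (F : Set (Arc α β)) u p d

theorem IsArborescenceOn.insert_arc {U : Finset α} {d : α} {F : Finset (Arc α β)} {e : Arc α β}
    (hF : IsArborescenceOn U d F) (hd : d ∈ U) (hs : e.src ∉ U) (ht : e.tgt ∈ U) :
    IsArborescenceOn (insert e.src U) d (insert e F) where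
  src_ne a ha := by
    rcases mem_insert.1 ha with rfl | ha
    · exact fun h => hs (h ▸ hd)
    · exact hF.src_ne a ha
  src_mem a ha := by
    rcases mem_insert.1 ha with rfl | ha
    · exact mem_insert_self _ _
    · exact mem_insert_of_mem (hF.src_mem a ha)
  tgt_mem a ha := by
    rcases mem_insert.1 ha with rfl | ha
    · exact mem_insert_of_mem ht
    · exact mem_insert_of_mem (hF.tgt_mem a ha)
  functional a ha b hb hab := by
    rcases mem_insert.1 ha with ha' | ha' <;> rcases mem_insert.1 hb with hb' | hb'
    · rw [ha', hb']
    · exact absurd (ha' ▸ hab ▸ hF.src_mem b hb') hs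
    · exact absurd (hb' ▸ hab ▸ hF.src_mem a ha') hs
    · exact hF.functional a ha' b hb' hab
  exists_walk u hu := by
    have hsub : (F : Set (Arc α β)) ⊆ (insert e F : Finset (Arc α β)) := by
      exact_mod_cast subset_insert e F
    rcases mem_insert.1 hu with rfl | hu
    · obtain ⟨p, hp⟩ := hF.exists_walk _ ht
      exact ⟨e :: p, by simp, rfl, hp.mono hsub⟩
    · obtain ⟨p, hp⟩ := hF.exists_walk _ hu
      exact ⟨p, hp.mono hsub⟩

/-- All arcs of `F` start in `U`, so none of them leaves a set disjoint from `U`. -/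
theorem IsArborescenceOn.outDegree_sdiff {U : Finset α} {d : α} {D F : Finset (Arc α β)}
    (hF : IsArborescenceOn U d F) {X : Finset α} (hX : Disjoint X U) :
    outDegree (D \ F) X = outDegree D X := by
  rw [outDegree, outDegree]
  congr 1
  ext a
  simp only [mem_filter, mem_sdiff]
  constructor
  · rintro ⟨⟨h1, _⟩, h2⟩
    exact ⟨h1, h2⟩
  · rintro ⟨h1, h2⟩
    exact ⟨⟨h1, fun h => disjoint_left.1 hX h2.1 (hF.src_mem a h)⟩, h2⟩

/-- An arborescence whose removal leaves all cuts of size at least `k` can be enlarged. -/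
theorem IsArborescenceOn.exists_extension {V U : Finset α} {d : α} {D F : Finset (Arc α β)}
    {k : ℕ} (hDV : ∀ a ∈ D, a.tgt ∈ V) (hD : IsCutBounded V d D (k + 1)) (hdU : d ∈ U)
    (hUV : U ⊂ V) (hF : IsArborescenceOn U d F) (hDF : IsCutBounded V d (D \ F) k) :
    ∃ e ∈ D, e.src ∈ V \ U ∧ e.tgt ∈ U ∧ IsCutBounded V d ((D \ F).erase e) k := by
  set A := D \ F with hA
  -- Removing `e` lowers a cut by at most one, and only if `e` leaves the set; so it is enough that
  -- `e` leaves no tight set, i.e. one left by exactly `k` arcs of `A`.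
  have key : ∀ e, (∀ Y ⊆ V, d ∉ Y → e.src ∈ Y → e.tgt ∉ Y → outDegree A Y ≠ k) →
      IsCutBounded V d (A.erase e) k := by
    intro e he Y hY hYne hdY
    by_cases hl : e.src ∈ Y ∧ e.tgt ∉ Y
    · have h1 := he Y hY hdY hl.1 hl.2
      have h2 := hDF Y hY hYne hdY
      have h3 := outDegree_le_outDegree_erase A Y e
      omega
    · rw [outDegree_erase_of_not_leaving hl]
      exact hDF Y hY hYne hdY
  -- As `e` will start outside `U`, only tight sets not contained in `U` can obstruct.
  set S := {X ∈ V.powerset | d ∉ X ∧ (X \ U).Nonempty ∧ outDegree A X = k} with hS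
  have memS : ∀ X, X ∈ S ↔ X ⊆ V ∧ d ∉ X ∧ (X \ U).Nonempty ∧ outDegree A X = k := by
    intro X
    simp [hS]
  by_cases hSne : S.Nonempty
  · obtain ⟨X, hX, hmin⟩ := S.exists_min_image card hSne
    obtain ⟨hXV, hdX, hXU, hXk⟩ := (memS X).1 hX
    -- More arcs of `A` leave `X \ U` than leave the tight set `X`, so some arc goes from `X \ U` to
    -- `X ∩ U`.
    have h1 : k + 1 ≤ outDegree A (X \ U) := by
      rw [hF.outDegree_sdiff sdiff_disjoint]
      exact hD _ (sdiff_subset.trans hXV) hXU fun h => hdX (mem_sdiff.1 h).1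
    obtain ⟨e, he, heX⟩ : ∃ e ∈ {a ∈ A | a.src ∈ X \ U ∧ a.tgt ∉ X \ U},
        e ∉ {a ∈ A | a.src ∈ X ∧ a.tgt ∉ X} := by
      refine exists_mem_notMem_of_card_lt_card ?_
      rw [outDegree] at h1 hXk
      omega
    simp only [mem_filter, mem_sdiff, not_and, not_not] at he heX
    obtain ⟨heA, ⟨hsX, hsU⟩, ht⟩ := he
    have htX := heX heA hsX
    have htU := ht htX
    refine ⟨e, (mem_sdiff.1 heA).1, mem_sdiff.2 ⟨hXV hsX, hsU⟩, htU, key e ?_⟩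
    intro Y hYV hdY hsY htY hYk
    -- Uncrossing: if `e` left a tight `Y`, then `X ∩ Y` would be tight too. It contains `e.src ∉ U`
    -- and misses `e.tgt ∈ X`, against the minimality of `X`.
    have hsub := outDegree_inter_add_union_le A X Y
    have hi := hDF (X ∩ Y) (inter_subset_left.trans hXV) ⟨_, mem_inter.2 ⟨hsX, hsY⟩⟩
      fun h => hdX (mem_inter.1 h).1
    have hu := hDF (X ∪ Y) (union_subset hXV hYV) ⟨_, mem_union_left _ hsX⟩ fun h =>
      (mem_union.1 h).elim hdX hdY
    have hmem : X ∩ Y ∈ S := (memS _).2 ⟨inter_subset_left.trans hXV,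
      fun h => hdX (mem_inter.1 h).1, ⟨_, mem_sdiff.2 ⟨mem_inter.2 ⟨hsX, hsY⟩, hsU⟩⟩, by omega⟩
    have hlt : #(X ∩ Y) < #X := card_lt_card
      ⟨inter_subset_left, fun h => htY (mem_inter.1 (h htX)).2⟩
    exact absurd (hmin _ hmem) (by omega)
  -- No tight set reaches outside `U`, so any arc from `V \ U` to `U` will do.
  · have h1 : 1 ≤ outDegree D (V \ U) := by
      refine le_trans (by omega) (hD (V \ U) sdiff_subset ?_ fun h => (mem_sdiff.1 h).2 hdU)
      exact sdiff_nonempty.2 hUV.2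
    obtain ⟨e, he⟩ := card_pos.1 h1
    obtain ⟨heD, hs, ht⟩ := mem_filter.1 he
    have htU : e.tgt ∈ U := by
      by_contra h
      exact ht (mem_sdiff.2 ⟨hDV e heD, h⟩)
    refine ⟨e, heD, hs, htU, key e fun Y hYV hdY hsY _ hYk => hSne ⟨Y, (memS Y).2 ?_⟩⟩
    exact ⟨hYV, hdY, ⟨_, mem_sdiff.2 ⟨hsY, (mem_sdiff.1 hs).2⟩⟩, hYk⟩

theorem exists_arborescence_of_isCutBounded {V : Finset α} {d : α} (hd : d ∈ V)
    {D : Finset (Arc α β)} (hDV : ∀ a ∈ D, a.tgt ∈ V) {k : ℕ} (hD : IsCutBounded V d D (k + 1)) :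
    ∃ F ⊆ D, IsArborescenceOn V d F ∧ IsCutBounded V d (D \ F) k := by
  -- The arborescence grows from `{d}`, by induction on the number of vertices not yet covered.
  suffices h : ∀ n, ∀ U ⊆ V, ∀ F ⊆ D, #(V \ U) = n → d ∈ U → IsArborescenceOn U d F →
      IsCutBounded V d (D \ F) k →
      ∃ F ⊆ D, IsArborescenceOn V d F ∧ IsCutBounded V d (D \ F) k by
    refine h _ {d} (singleton_subset_iff.2 hd) ∅ (empty_subset _) rfl (mem_singleton_self d)
      ⟨by simp, by simp, by simp, by simp, fun u hu => ⟨[], mem_singleton.1 hu⟩⟩ ?_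
    intro X hX hXne hdX
    rw [sdiff_empty]
    exact (Nat.le_succ k).trans (hD X hX hXne hdX)
  intro n
  induction n with
  | zero =>
    intro U hU F hFD hn _ hF hc
    obtain rfl := hU.antisymm (sdiff_eq_empty_iff_subset.1 (card_eq_zero.1 hn))
    exact ⟨F, hFD, hF, hc⟩
  | succ n ih =>
    intro U hU F hFD hn hdU hF hc
    have hUV : U ⊂ V := ⟨hU, fun h => by simp [sdiff_eq_empty_iff_subset.2 h] at hn⟩
    obtain ⟨e, heD, hs, ht, he⟩ := hF.exists_extension hDV hD hdU hUV hc
    obtain ⟨hsV, hsU⟩ := mem_sdiff.1 hs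
    refine ih (insert e.src U) (insert_subset hsV hU) (insert e F) (insert_subset heD hFD) ?_
      (mem_insert_of_mem hdU) (hF.insert_arc hdU hsU ht) ?_
    · rw [sdiff_insert, card_erase_of_mem hs, hn, Nat.add_sub_cancel]
    · rwa [sdiff_insert]

/-- Edmonds' theorem on disjoint arborescences. -/
theorem exists_disjoint_arborescences {V : Finset α} {d : α} (hd : d ∈ V) (k : ℕ)
    {D : Finset (Arc α β)} (hDV : ∀ a ∈ D, a.tgt ∈ V) (hD : IsCutBounded V d D k) :
    ∃ T : Fin k → Finset (Arc α β), (∀ i, T i ⊆ D ∧ IsArborescenceOn V d (T i)) ∧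
      ∀ i j, i ≠ j → Disjoint (T i) (T j) := by
  induction k generalizing D with
  | zero => exact ⟨fun _ => ∅, fun i => i.elim0, fun i => i.elim0⟩
  | succ k ih =>
    obtain ⟨F, hFD, hF, hc⟩ := exists_arborescence_of_isCutBounded hd hDV hD
    obtain ⟨T, hT, hdisj⟩ := ih (fun a ha => hDV a (mem_sdiff.1 ha).1) hc
    have hFT : ∀ i, Disjoint F (T i) := fun i => disjoint_sdiff.mono_right (hT i).1
    refine ⟨Fin.cons F T, fun i => ?_, fun i j => ?_⟩
    · cases i using Fin.cases with
      | zero => exact ⟨hFD, hF⟩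
      | succ i => exact ⟨(hT i).1.trans sdiff_subset, (hT i).2⟩
    · cases i using Fin.cases with
      | zero =>
        cases j using Fin.cases with
        | zero => exact fun h => absurd rfl h
        | succ j => exact fun _ => hFT j
      | succ i =>
        cases j using Fin.cases with
        | zero => exact fun _ => (hFT i).symm
        | succ j => exact fun h => hdisj i j fun h' => h (h' ▸ rfl)

/-- Each of the `k` paths from a vertex of `X` to `d` leaves `X`, and edge-disjointness makes the
leaving arcs distinct. -/
theorem IsEdgeConnected.isCutBounded {G : Graph α β} (hV : G.vertexSet.Finite)
    (hA : (arcs G).Finite) {k : ℕ} (hG : IsEdgeConnected G k) {d : α} (hd : d ∈ G.vertexSet) :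
    IsCutBounded hV.toFinset d hA.toFinset k := by
  intro X hXV ⟨u, hu⟩ hdX
  obtain ⟨P, hP, hdisj⟩ := hG u (hV.mem_toFinset.1 (hXV hu)) d hd fun h => hdX (h ▸ hu)
  have h : ∀ i, ∃ a ∈ P i, a.src ∈ X ∧ a.tgt ∉ X := fun i =>
    (hP i).1.exists_leaving (X := (X : Set α)) hu hdX
  choose a haP ha using h
  have hinj : Function.Injective a := fun i j hij => by
    by_contra hne
    exact hdisj i j hne _ (haP i) _ (haP j) (congrArg Arc.edge hij)
  calc k = #(univ.image a) := by rw [card_image_of_injective _ hinj, card_univ, Fintype.card_fin]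
    _ ≤ _ := card_le_card fun b hb => by
      obtain ⟨i, -, rfl⟩ := mem_image.1 hb
      exact mem_filter.2 ⟨hA.mem_toFinset.2 ((hP i).1.mem _ (haP i)), ha i⟩

end Edmonds

theorem IsEdgeConnected.exists_disjoint_spanningArborescences {G : Graph α β}
    (hV : G.vertexSet.Finite) (hE : G.edgeSet.Finite) {k : ℕ} (hG : IsEdgeConnected G k) {d : α}
    (hd : d ∈ G.vertexSet) :
    ∃ T : Fin k → Set (Arc α β), (∀ i, IsSpanningArborescence G d (T i)) ∧
      ∀ i j, i ≠ j → Disjoint (T i) (T j) := by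
  have hA := arcs_finite hV hE
  obtain ⟨T, hT, hdisj⟩ := exists_disjoint_arborescences (V := hV.toFinset) (d := d)
    (hV.mem_toFinset.2 hd) k (D := hA.toFinset)
    (fun a ha => hV.mem_toFinset.2 (tgt_mem_of_mem_arcs (hA.mem_toFinset.1 ha)))
    (hG.isCutBounded hV hA hd)
  refine ⟨fun i => T i, fun i => ?_, fun i j hij => Finset.disjoint_coe.2 (hdisj i j hij)⟩
  exact isSpanningArborescence_of_functional hd (fun a ha => hA.mem_toFinset.1 ((hT i).1 ha))
    (hT i).2.src_ne (hT i).2.functional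
    fun v hv => (hT i).2.exists_walk v (hV.mem_toFinset.2 hv)

/-! ### Depth-first traversals exist -/

section Existence

variable {G : Graph α β} {d : α} {T : Set (Arc α β)}

theorem exists_isChildOrder (hT : T.Finite) (x : α) : ∃ cs, IsChildOrder T x cs := by
  have hf : {a | a ∈ T ∧ a.tgt = x}.Finite := hT.subset fun a ha => ha.1
  exact ⟨hf.toFinset.toList, Finset.nodup_toList _, fun a => by simp⟩

theorem IsSpanningArborescence.exists_isTour (hT : IsSpanningArborescence G d T) (hfin : T.Finite)
    (x : α) (cs : List (Arc α β)) (hcs : ∀ a ∈ cs, a ∈ T ∧ a.tgt = x) : ∃ w, IsTour T x cs w := by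
  -- The recursion is on the number of arcs of `T` in the subtree hanging at `x`.
  suffices h : ∀ n x, {b ∈ T | ∃ p, IsWalk T b.tgt p x}.ncard = n →
      ∀ cs : List (Arc α β), (∀ a ∈ cs, a ∈ T ∧ a.tgt = x) → ∃ w, IsTour T x cs w from
    h _ x rfl cs hcs
  intro n
  induction n using Nat.strong_induction_on with
  | _ n ih =>
    intro x hn cs hcs
    induction cs with
    | nil => exact ⟨[], .nil x⟩
    | cons a cs ih' =>
      obtain ⟨w', hw'⟩ := ih' fun b hb => hcs b (List.mem_cons_of_mem _ hb)
      obtain ⟨ha, hax⟩ := hcs a List.mem_cons_self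
      obtain ⟨us, hus⟩ := exists_isChildOrder hfin a.src
      have hlt : {b ∈ T | ∃ p, IsWalk T b.tgt p a.src}.ncard < n := by
        rw [← hn]
        refine Set.ncard_lt_ncard ⟨?_, fun h => ?_⟩ (hfin.subset fun b hb => hb.1)
        · rintro b ⟨hb, p, hp⟩
          exact ⟨hb, p ++ [a], hp.append ⟨ha, rfl, hax⟩⟩
        -- The arc `a` is counted at `x` but not at `a.src`, where it would close a cycle.
        · obtain ⟨-, p, hp⟩ := h (a := a) ⟨ha, [], hax⟩
          have := hT.eq_nil_of_closed (src_mem_of_mem_arcs (hT.subset_arcs ha))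
            (p := a :: p) ⟨ha, rfl, hp⟩
          simp at this
      obtain ⟨w, hw⟩ := ih _ hlt a.src rfl us fun b hb => (hus.2 b).1 hb
      exact ⟨_, .cons ha hax hus hw hw'⟩

theorem IsSpanningArborescence.exists_isDFSTraversal (hT : IsSpanningArborescence G d T)
    (hfin : T.Finite) : ∃ R, IsDFSTraversal T d R := by
  obtain ⟨cs, hcs⟩ := exists_isChildOrder hfin d
  obtain ⟨w, hw⟩ := hT.exists_isTour hfin d cs fun a ha => (hcs.2 a).1 ha
  exact ⟨w, cs, hcs, hw⟩

end Existence

theorem IsEdgeConnected.exists_isDFInput {G : Graph α β} (hV : G.vertexSet.Finite)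
    (hE : G.edgeSet.Finite) {k : ℕ} (hG : IsEdgeConnected G k) {d : α} (hd : d ∈ G.vertexSet) :
    ∃ (T : Fin k → Set (Arc α β)) (R : Fin k → List (Arc α β)), IsDFInput G d T R := by
  obtain ⟨T, hT, hdisj⟩ := hG.exists_disjoint_spanningArborescences hV hE hd
  choose R hR using fun i =>
    (hT i).exists_isDFSTraversal ((arcs_finite hV hE).subset (hT i).subset_arcs)
  exact ⟨T, R, hT, hdisj, hR⟩

/-! ### Properties of depth-first traversals -/

section Traversal

variable {G : Graph α β} {d : α} {T : Set (Arc α β)}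

/-- The edge of `b` lies in the subtree of `T` hanging at `x`, or is the edge leaving `x`. -/
def IsBelow (T : Set (Arc α β)) (b : Arc α β) (x : α) : Prop :=
  ∃ t ∈ T, (b = t ∨ b = t.rev) ∧ ∃ p, IsWalk T t.src p x

theorem IsTour.mem_of_mem_children {x : α} {cs w : List (Arc α β)} (h : IsTour T x cs w) :
    ∀ a ∈ cs, a ∈ T ∧ a.tgt = x := by
  induction h with
  | nil => simp
  | cons ha hax _ _ _ _ ih =>
    simp only [List.mem_cons, forall_eq_or_imp]
    exact ⟨⟨ha, hax⟩, ih⟩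

theorem IsTour.isBelow {x : α} {cs w : List (Arc α β)} (h : IsTour T x cs w) :
    ∀ b ∈ w, ∃ c ∈ cs, IsBelow T b c.src := by
  induction h with
  | nil => simp
  | @cons x a cs us w w' ha hax hus hw hw' ih ih' =>
    intro b hb
    simp only [List.mem_cons, List.mem_append] at hb
    rcases hb with rfl | hb | rfl | hb
    · exact ⟨a, List.mem_cons_self, a, ha, .inr rfl, [], rfl⟩
    · obtain ⟨c, hc, t, ht, hbt, p, hp⟩ := ih b hb
      obtain ⟨hcT, hca⟩ := (hus.2 c).1 hc
      exact ⟨a, List.mem_cons_self, t, ht, hbt, p ++ [c], hp.append ⟨hcT, rfl, hca⟩⟩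
    · exact ⟨b, List.mem_cons_self, b, ha, .inl rfl, [], rfl⟩
    · obtain ⟨c, hc, h⟩ := ih' b hb
      exact ⟨c, List.mem_cons_of_mem _ hc, h⟩

theorem IsTour.mem_or_rev_mem {x : α} {cs w : List (Arc α β)} (h : IsTour T x cs w) {b : Arc α β}
    (hb : b ∈ w) : b ∈ T ∨ b.rev ∈ T := by
  obtain ⟨-, -, t, ht, rfl | rfl, -⟩ := h.isBelow b hb
  · exact .inl ht
  · exact .inr ht

theorem IsTour.isWalk {x : α} {cs w : List (Arc α β)} (h : IsTour T x cs w) :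
    IsWalk (T ∪ {a | a.rev ∈ T}) x w x := by
  induction h with
  | nil => rfl
  | cons ha hax _ _ _ ih ih' =>
    exact ⟨.inr ha, hax, ih.append ⟨.inl ha, rfl, hax ▸ ih'⟩⟩

/-- `T` never contains both arcs on an edge, so `b` determines `t`, and subtrees of different
children are disjoint. -/
theorem IsSpanningArborescence.isBelow_unique (hT : IsSpanningArborescence G d T)
    {b c c' : Arc α β} (hb : IsBelow T b c.src) (hb' : IsBelow T b c'.src) (hc : c ∈ T)
    (hc' : c' ∈ T) (h : c.tgt = c'.tgt) : c = c' := by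
  obtain ⟨t, ht, hbt, p, hp⟩ := hb
  obtain ⟨t', ht', hbt', q, hq⟩ := hb'
  obtain rfl : t = t' := by
    rcases hbt with rfl | rfl <;> rcases hbt' with h | h
    · exact h
    · exact absurd (h ▸ ht) (hT.rev_notMem ht')
    · exact absurd (h ▸ ht') (hT.rev_notMem ht)
    · exact Arc.rev_injective h
  exact hT.child_unique hp hq hc hc' h

theorem IsSpanningArborescence.not_isBelow_child (hT : IsSpanningArborescence G d T)
    {a b c : Arc α β} (ha : a ∈ T) (hb : b = a ∨ b = a.rev) (hc : c ∈ T) (hca : c.tgt = a.src) :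
    ¬IsBelow T b c.src := by
  rintro ⟨t, ht, hbt, p, hp⟩
  obtain rfl : t = a := by
    rcases hb with rfl | rfl <;> rcases hbt with h | h
    · exact h.symm
    · exact absurd (h ▸ ha) (hT.rev_notMem ht)
    · exact absurd (h ▸ ht) (hT.rev_notMem ha)
    · exact (Arc.rev_injective h).symm
  have := hT.eq_nil_of_closed (src_mem_of_mem_arcs (hT.subset_arcs ha)) (p := p ++ [c])
    (hp.append ⟨hc, rfl, hca⟩)
  simp at this

/-- The arcs of `w` lie strictly below `a`, and those of `w'` in the subtrees of the other children.
-/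
theorem IsTour.nodup (hT : IsSpanningArborescence G d T) {x : α} {cs w : List (Arc α β)}
    (h : IsTour T x cs w) (hcs : cs.Nodup) : w.Nodup := by
  induction h with
  | nil => exact List.nodup_nil
  | @cons x a cs us w w' ha hax hus hw hw' ih ih' =>
    have hacs := (List.nodup_cons.1 hcs).1
    have h1 : ∀ b ∈ w, IsBelow T b a.src ∧ ¬(b = a ∨ b = a.rev) := fun b hb => by
      obtain ⟨c, hc, t, ht, hbt, p, hp⟩ := hw.isBelow b hb
      obtain ⟨hcT, hca⟩ := (hus.2 c).1 hc
      exact ⟨⟨t, ht, hbt, p ++ [c], hp.append ⟨hcT, rfl, hca⟩⟩,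
        fun h => hT.not_isBelow_child ha h hcT hca ⟨t, ht, hbt, p, hp⟩⟩
    have h2 : ∀ b ∈ w', ¬IsBelow T b a.src := fun b hb hba => by
      obtain ⟨c, hc, hbc⟩ := hw'.isBelow b hb
      obtain ⟨hcT, hcx⟩ := hw'.mem_of_mem_children c hc
      exact hacs (hT.isBelow_unique hba hbc ha hcT (hax.trans hcx.symm) ▸ hc)
    have h3 : a ∉ w' := fun h => h2 a h ⟨a, ha, .inl rfl, [], rfl⟩
    have h4 : a.rev ∉ w' := fun h => h2 _ h ⟨a, ha, .inr rfl, [], rfl⟩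
    have h5 : a.rev ≠ a := fun h => hT.rev_notMem ha (h.symm ▸ ha)
    rw [List.nodup_cons, List.nodup_append, List.nodup_cons]
    refine ⟨?_, ih hus.1, ⟨h3, ih' (List.nodup_cons.1 hcs).2⟩, ?_⟩
    · simp only [List.mem_append, List.mem_cons, not_or]
      exact ⟨fun h => (h1 _ h).2 (.inr rfl), h5, h4⟩
    · intro b hb c hc hbc
      subst hbc
      rcases List.mem_cons.1 hc with rfl | hc
      · exact (h1 _ hb).2 (.inl rfl)
      · exact h2 b hc (h1 b hb).1

theorem IsTour.mem_of_isWalk {x : α} {cs w : List (Arc α β)} (h : IsTour T x cs w) :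
    ∀ t ∈ T, ∀ c ∈ cs, ∀ p, IsWalk T t.src p c.src →
      (∀ a ∈ T, ∀ b ∈ T, a.src = b.src → a = b) → t.rev ∈ w := by
  induction h with
  | nil => simp
  | @cons x a cs us w w' ha hax hus hw hw' ih ih' =>
    intro t ht c hc p hp hfun
    rcases List.mem_cons.1 hc with rfl | hc
    -- The last arc of `p` is the child by which the tour descends at the next level.
    · rcases List.eq_nil_or_concat p with rfl | ⟨p, u, rfl⟩
      · rw [hfun t ht c ha hp]
        exact List.mem_cons_self
      · obtain ⟨v, hp, hu, rfl, hv⟩ := isWalk_append.1 (by simpa using hp)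
        exact List.mem_cons_of_mem _ (List.mem_append_left _
          (ih t ht u ((hus.2 u).2 ⟨hu, hv⟩) p hp hfun))
    · exact List.mem_cons_of_mem _ (List.mem_append_right _ (List.mem_cons_of_mem _
        (ih' t ht c hc p hp hfun)))

theorem suffix_append_cases {γ : Type*} {s l l' : List γ} (h : s <:+ l ++ l') :
    s <:+ l' ∨ ∃ s', s = s' ++ l' ∧ s' <:+ l := by
  obtain ⟨t, ht⟩ := h
  rcases List.append_eq_append_iff.1 ht with ⟨r, rfl, rfl⟩ | ⟨r, rfl, rfl⟩
  · exact .inr ⟨r, rfl, List.suffix_append t r⟩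
  · exact .inl (List.suffix_append r s)

/-- Every edge is traversed down before it is traversed up. -/
theorem IsTour.mem_suffix (hT : IsSpanningArborescence G d T) {x : α} {cs w : List (Arc α β)}
    (h : IsTour T x cs w) : ∀ s, s <:+ w → ∀ a ∈ T, a.rev ∈ s → a ∈ s := by
  induction h with
  | nil =>
    intro s hs
    simp [List.suffix_nil.1 hs]
  | @cons x a cs us w w' ha hax hus hw hw' ih ih' =>
    -- The order is expressed by suffixes: one that still contains the descent also contains the
    -- ascent. A suffix starting inside `w` contains all of `a :: w'`.
    intro s hs t ht hts
    rcases List.suffix_cons_iff.1 hs with rfl | hs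
    · simp only [List.mem_cons, List.mem_append] at hts ⊢
      rcases hts with h | h | h | h
      · exact .inr (.inr (.inl (Arc.rev_injective h)))
      · exact .inr (.inl (ih w List.suffix_rfl t ht h))
      · exact absurd (h ▸ ha) (hT.rev_notMem ht)
      · exact .inr (.inr (.inr (ih' w' List.suffix_rfl t ht h)))
    · rcases suffix_append_cases hs with hs | ⟨s', rfl, hs'⟩
      · rcases List.suffix_cons_iff.1 hs with rfl | hs
        · rcases List.mem_cons.1 hts with h | h
          · exact absurd (h ▸ ha) (hT.rev_notMem ht)
          · exact List.mem_cons_of_mem _ (ih' w' List.suffix_rfl t ht h)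
        · exact ih' s hs t ht hts
      · simp only [List.mem_cons, List.mem_append] at hts ⊢
        rcases hts with h | h | h
        · exact .inl (ih s' hs' t ht h)
        · exact absurd (h ▸ ha) (hT.rev_notMem ht)
        · exact .inr (.inr (ih' w' List.suffix_rfl t ht h))

variable {R : List (Arc α β)}

theorem IsDFSTraversal.nodup (hR : IsDFSTraversal T d R) (hT : IsSpanningArborescence G d T) :
    R.Nodup := by
  obtain ⟨cs, hcs, hw⟩ := hR
  exact hw.nodup hT hcs.1

theorem IsDFSTraversal.mem_or_rev_mem (hR : IsDFSTraversal T d R) {a : Arc α β} (ha : a ∈ R) :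
    a ∈ T ∨ a.rev ∈ T := by
  obtain ⟨cs, hcs, hw⟩ := hR
  exact hw.mem_or_rev_mem ha

theorem IsDFSTraversal.mem_of_suffix (hR : IsDFSTraversal T d R)
    (hT : IsSpanningArborescence G d T) {s : List (Arc α β)} (hs : s <:+ R) {a : Arc α β}
    (ha : a ∈ T) (has : a.rev ∈ s) : a ∈ s := by
  obtain ⟨cs, hcs, hw⟩ := hR
  exact hw.mem_suffix hT s hs a ha has

/-- The descent on the edge occurs by recursion along the path to `d`, and an ascent follows every
descent. -/
theorem IsDFSTraversal.mem (hR : IsDFSTraversal T d R) (hT : IsSpanningArborescence G d T)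
    {a : Arc α β} (ha : a ∈ T) : a ∈ R := by
  refine hR.mem_of_suffix hT List.suffix_rfl ha ?_
  obtain ⟨cs, hcs, hw⟩ := hR
  obtain ⟨p, hp⟩ := hT.exists_walk (src_mem_of_mem_arcs (hT.subset_arcs ha))
  rcases List.eq_nil_or_concat p with rfl | ⟨p, u, rfl⟩
  · exact absurd hp (hT.root_out a ha)
  · obtain ⟨v, hp, hu, rfl, hv⟩ := isWalk_append.1 (by simpa using hp)
    exact hw.mem_of_isWalk a ha u ((hcs.2 u).2 ⟨hu, hv⟩) p hp
      fun _ ha _ hb => hT.eq_of_src_eq ha hb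

theorem IsDFSTraversal.isWalk (hR : IsDFSTraversal T d R) (hT : IsSpanningArborescence G d T) :
    IsWalk (arcs G) d R d := by
  obtain ⟨cs, hcs, hw⟩ := hR
  refine hw.isWalk.mono ?_
  rintro a (ha | ha)
  · exact hT.subset_arcs ha
  · exact rev_mem_arcs (hT.subset_arcs ha)

end Traversal

/-! ### First and last failed arcs of a traversal -/

theorem exists_eq_append_cons_of_last {γ : Type*} {P : γ → Prop} {l : List γ} (h : ∃ b ∈ l, P b) :
    ∃ l₁ b l₂, l = l₁ ++ b :: l₂ ∧ P b ∧ ∀ c ∈ l₂, ¬P c := by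
  induction l with
  | nil => simp at h
  | cons x l ih =>
    by_cases hl : ∃ b ∈ l, P b
    · obtain ⟨l₁, b, l₂, rfl, hb⟩ := ih hl
      exact ⟨x :: l₁, b, l₂, rfl, hb⟩
    · push Not at hl
      obtain ⟨b, hb, hPb⟩ := h
      rcases List.mem_cons.1 hb with rfl | hb
      · exact ⟨[], b, l, rfl, hPb, hl⟩
      · exact absurd hPb (hl b hb)

theorem exists_eq_append_cons_of_first {γ : Type*} {P : γ → Prop} {l : List γ}
    (h : ∃ b ∈ l, P b) : ∃ l₁ b l₂, l = l₁ ++ b :: l₂ ∧ P b ∧ ∀ c ∈ l₁, ¬P c := by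
  induction l with
  | nil => simp at h
  | cons x l ih =>
    by_cases hx : P x
    · exact ⟨[], x, l, rfl, hx, by simp⟩
    · obtain ⟨b, hb, hPb⟩ := h
      rcases List.mem_cons.1 hb with rfl | hb
      · exact absurd hPb hx
      · obtain ⟨l₁, b, l₂, rfl, hb, hl⟩ := ih ⟨b, hb, hPb⟩
        exact ⟨x :: l₁, b, l₂, rfl, hb, by simpa [hx] using hl⟩

/-- The last failed arc of a depth-first traversal belongs to the arborescence. -/
theorem IsDFSTraversal.exists_last_failed {G : Graph α β} {d : α} {T : Set (Arc α β)}
    {R : List (Arc α β)} (hR : IsDFSTraversal T d R) (hT : IsSpanningArborescence G d T)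
    {F : Set β} (h : ∃ a ∈ T, a.edge ∈ F) :
    ∃ l₁ a l₂, R = l₁ ++ a :: l₂ ∧ a ∈ T ∧ a.edge ∈ F ∧ ∀ b ∈ l₂, b.edge ∉ F := by
  obtain ⟨a, ha, haF⟩ := h
  obtain ⟨l₁, b, l₂, rfl, hb, hl⟩ :=
    exists_eq_append_cons_of_last (P := fun b : Arc α β => b.edge ∈ F) ⟨a, hR.mem hT ha, haF⟩
  refine ⟨l₁, b, l₂, rfl, ?_, hb, hl⟩
  -- If `b` were a descent, the ascent on the same failed edge would follow it.
  by_contra hbT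
  have hbT' : b.rev ∈ T := (hR.mem_or_rev_mem (a := b) (by simp)).resolve_left hbT
  have := hR.mem_of_suffix hT (List.suffix_append l₁ (b :: l₂)) hbT' (by simp)
  rcases List.mem_cons.1 this with h | h
  · exact hbT (h ▸ hbT')
  · exact hl _ h hb

/-! ### Decisions that lead to the destination -/

section Algorithm

open Classical

variable {k : ℕ} [NeZero k]

@[simp] theorem decodeMode_encode (m : Mode) (H : Bool) : decodeMode (encode m H) = m := by
  cases m <;> simp [decodeMode, encode]

@[simp] theorem decodeH_encode (m : Mode) (H : Bool) : decodeH (encode m H) = H := by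
  cases m <;> simp [decodeH, encode]

/-- The decision `t`, taken at the vertex `t.arc.src`, makes the packet arrive at `d` when the
edges in `F` have failed. -/
inductive Succeeds (G : Graph α β) (d : α) (T : Fin k → Set (Arc α β))
    (R : Fin k → List (Arc α β)) (F : Set β) : Attempt α β → Prop
  | arrive {t : Attempt α β} : t.arc ∈ arcs G → t.arc.edge ∉ F → t.arc.tgt = d →
      Succeeds G d T R F t
  | hop {t t' : Attempt α β} : t.arc ∈ arcs G → t.arc.edge ∉ F → t.arc.tgt ≠ d →
      firstAttempt G T R t.arc.tgt (some t.arc.edge) (encode t.mode t.H) = some t' →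
      t'.arc.src = t.arc.tgt → Succeeds G d T R F t' → Succeeds G d T R F t
  | retry {t t' : Attempt α β} : t.arc.edge ∈ F → retry T R t = some t' →
      t'.arc.src = t.arc.src → Succeeds G d T R F t' → Succeeds G d T R F t

theorem dfAlgo_eq_of_attempt {G : Graph α β} {T : Fin k → Set (Arc α β)}
    {R : Fin k → List (Arc α β)} {v : α} {inc : Option β} {A : Set β} {h : Fin 3 → Bool} {n : ℕ}
    {t : Attempt α β} (ht : attempt G T R v inc h n = some t) (hA : t.arc.edge ∈ A)
    (hlt : ∀ m < n, ∀ s ∈ attempt G T R v inc h m, s.arc.edge ∉ A) :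
    dfAlgo G T R v inc A h = some (t.arc.edge, encode t.mode t.H) := by
  have hn : ∃ n, ∃ t ∈ attempt G T R v inc h n, t.arc.edge ∈ A := ⟨n, t, ht, hA⟩
  have hfind : Nat.find hn = n :=
    (Nat.find_eq_iff hn).2 ⟨⟨t, ht, hA⟩, fun m hm ⟨s, hs, hsA⟩ => hlt m hm s hs hsA⟩
  rw [dfAlgo, dif_pos hn, hfind, ht, Option.map_some]

/-- The number `n` counts the decisions already rejected at the current vertex: a retry increases
it, a hop resets it to `0`. -/
theorem Succeeds.exists_reflTransGen {G : Graph α β} {d : α} {T : Fin k → Set (Arc α β)}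
    {R : Fin k → List (Arc α β)} {F : Set β} {t : Attempt α β} (ht : Succeeds G d T R F t) :
    ∀ (inc : Option β) (h : Fin 3 → Bool) (n : ℕ), t.arc.src ≠ d →
      attempt G T R t.arc.src inc h n = some t →
      (∀ m < n, ∀ s ∈ attempt G T R t.arc.src inc h m,
        s.arc.edge ∉ activeEdges G F t.arc.src) →
      ∃ q : Packet α β 3, q.pos = d ∧
        Relation.ReflTransGen (Hop G d (dfAlgo G T R) F) ⟨t.arc.src, inc, h⟩ q := by
  have hHop : ∀ (t : Attempt α β) (inc : Option β) (h : Fin 3 → Bool) (n : ℕ),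
      t.arc ∈ arcs G → t.arc.edge ∉ F → t.arc.src ≠ d →
      attempt G T R t.arc.src inc h n = some t →
      (∀ m < n, ∀ s ∈ attempt G T R t.arc.src inc h m,
        s.arc.edge ∉ activeEdges G F t.arc.src) →
      Hop G d (dfAlgo G T R) F ⟨t.arc.src, inc, h⟩
        ⟨t.arc.tgt, some t.arc.edge, encode t.mode t.H⟩ := by
    intro t inc h n hG hF hd hn hlt
    have hA : t.arc.edge ∈ activeEdges G F t.arc.src := ⟨Graph.IsLink.inc_left hG, hF⟩
    exact ⟨hd, _, hA, dfAlgo_eq_of_attempt hn hA hlt, hG, rfl⟩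
  induction ht with
  | arrive hG hF htd =>
    intro inc h n hd hn hlt
    exact ⟨_, htd, .single (hHop _ inc h n hG hF hd hn hlt)⟩
  | @hop t t' hG hF htd hfirst hsrc _ ih =>
    intro inc h n hd hn hlt
    obtain ⟨q, hq, hpath⟩ := ih (some t.arc.edge) (encode t.mode t.H) 0 (hsrc ▸ htd)
      (hsrc ▸ hfirst) fun m hm => absurd hm (Nat.not_lt_zero m)
    exact ⟨q, hq, .head (hHop t inc h n hG hF hd hn hlt) (hsrc ▸ hpath)⟩
  | @retry t t' hF hretry hsrc _ ih =>
    intro inc h n hd hn hlt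
    rw [← hsrc]
    refine ih inc h (n + 1) (hsrc ▸ hd) ?_ ?_
    · rw [hsrc, attempt, hn, Option.bind_some, hretry]
    · intro m hm s hs
      rw [hsrc] at hs ⊢
      rcases Nat.lt_succ_iff_lt_or_eq.1 hm with hm | rfl
      · exact hlt m hm s hs
      · rw [hn, Option.mem_some_iff] at hs
        exact fun h => h.2 (hs ▸ hF)

/-! ### Arborescences sharing an edge -/

omit [NeZero k] in
theorem mem_treeIndices {T : Fin k → Set (Arc α β)} {e : β} {i : Fin k} :
    i ∈ treeIndices T e ↔ ∃ a ∈ T i, a.edge = e := by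
  simp [treeIndices]

theorem treeIndexGivenH_mem {T : Fin k → Set (Arc α β)} {e : β} (h : (treeIndices T e).Nonempty)
    (H : Bool) : treeIndexGivenH T H e ∈ treeIndices T e := by
  rw [treeIndexGivenH, dif_pos h]
  split_ifs
  · exact Finset.max'_mem _ h
  · exact Finset.min'_mem _ h

theorem treeIndexGivenH_false_le_true (T : Fin k → Set (Arc α β)) (e : β) {i : Fin k}
    (hi : i ∈ treeIndices T e) :
    treeIndexGivenH T false e ≤ i ∧ i ≤ treeIndexGivenH T true e := by
  have h : (treeIndices T e).Nonempty := ⟨i, hi⟩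
  rw [treeIndexGivenH, dif_pos h, treeIndexGivenH, dif_pos h]
  exact ⟨Finset.min'_le _ _ hi, Finset.le_max' _ _ hi⟩

/-- Of two indices, the one that is not the maximum is the minimum. The case `i = j` covers unshared
edges. -/
theorem treeIndexGivenH_hGivenTreeIndex_left {T : Fin k → Set (Arc α β)} {e : β} {i j : Fin k}
    (h : treeIndices T e = {i, j}) :
    treeIndexGivenH T (hGivenTreeIndex T i e) e = i := by
  have hi : i ∈ treeIndices T e := by simp [h]
  by_cases hmax : i = treeIndexGivenH T true e
  · rw [hGivenTreeIndex, decide_eq_true hmax]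
    exact hmax.symm
  · rw [hGivenTreeIndex, decide_eq_false hmax]
    have h1 := treeIndexGivenH_mem ⟨i, hi⟩ true
    have h2 := treeIndexGivenH_mem ⟨i, hi⟩ false
    have h3 := treeIndexGivenH_false_le_true T e hi
    simp only [h, Finset.mem_insert, Finset.mem_singleton] at h1 h2
    rcases h1 with h1 | h1
    · exact absurd h1.symm hmax
    · rcases h2 with h2 | h2
      · exact h2
      · exact absurd (le_antisymm h3.2 (h1.trans_le (h2 ▸ h3.1))) hmax

/-- Flipping `H` gives the other arborescence on the edge. For `i = j` it gives `i` again, which is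
how `retry` recognises an unshared edge. -/
theorem treeIndexGivenH_not_hGivenTreeIndex {T : Fin k → Set (Arc α β)} {e : β} {i j : Fin k}
    (h : treeIndices T e = {i, j}) :
    treeIndexGivenH T (!hGivenTreeIndex T i e) e = j := by
  have h' : treeIndices T e = {j, i} := by rw [h, Finset.pair_comm]
  by_cases hij : i = j
  · subst hij
    have := treeIndexGivenH_mem (T := T) (e := e) ⟨i, by simp [h]⟩ (!hGivenTreeIndex T i e)
    simpa [h] using this
  · have hj := treeIndexGivenH_hGivenTreeIndex_left h'
    suffices hnot : (!hGivenTreeIndex T i e) = hGivenTreeIndex T j e by rw [hnot, hj]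
    have h1 := treeIndexGivenH_mem (T := T) (e := e) ⟨i, by simp [h]⟩ true
    simp only [h, Finset.mem_insert, Finset.mem_singleton] at h1
    rcases h1 with h1 | h1
    · simp [hGivenTreeIndex, h1, Ne.symm hij]
    · simp [hGivenTreeIndex, h1, hij]

/-! ### Successors in traversals and reversed walks -/

theorem nextArcIn_append {a b : Arc α β} {l₁ l₂ : List (Arc α β)} (h : a ∉ l₁) :
    nextArcIn a (l₁ ++ a :: b :: l₂) = some b := by
  induction l₁ with
  | nil => simp [nextArcIn]
  | cons x l ih =>
    obtain ⟨hx, hl⟩ := not_or.1 (mt List.mem_cons.2 h)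
    cases l with
    | nil => simp [nextArcIn, Ne.symm hx]
    | cons y l => simpa [nextArcIn, Ne.symm hx] using ih hl

theorem IsWalk.src_eq_tgt {A : Set (Arc α β)} {u v : α} {l₁ l₂ : List (Arc α β)}
    {a b : Arc α β} (h : IsWalk A u (l₁ ++ a :: b :: l₂) v) : b.src = a.tgt := by
  obtain ⟨w, -, -, -, -, h, -⟩ := isWalk_append.1 h
  exact h

theorem inverseTraversal_append (p q : List (Arc α β)) :
    inverseTraversal (p ++ q) = inverseTraversal q ++ inverseTraversal p := by
  simp [inverseTraversal]

theorem inverseTraversal_cons (a : Arc α β) (p : List (Arc α β)) :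
    inverseTraversal (a :: p) = inverseTraversal p ++ [a.rev] := by
  simp [inverseTraversal]

theorem mem_inverseTraversal {a : Arc α β} {p : List (Arc α β)} :
    a ∈ inverseTraversal p ↔ a.rev ∈ p := by
  simp only [inverseTraversal, List.mem_reverse, List.mem_map]
  exact ⟨fun ⟨b, hb, h⟩ => h ▸ hb, fun h => ⟨a.rev, h, rfl⟩⟩

theorem IsWalk.inverseTraversal {G : Graph α β} {u v : α} {p : List (Arc α β)}
    (h : IsWalk (arcs G) u p v) : IsWalk (arcs G) v (inverseTraversal p) u := by
  induction p generalizing u with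
  | nil => exact Eq.symm h
  | cons a p ih =>
    obtain ⟨ha, rfl, hp⟩ := h
    rw [inverseTraversal_cons]
    exact (ih hp).append (isWalk_singleton (rev_mem_arcs ha))

theorem outArc_eq {G : Graph α β} {d : α} {T : Set (Arc α β)}
    (hT : IsSpanningArborescence G d T) {a : Arc α β} (ha : a ∈ T) :
    outArc T a.src = some a := by
  have h : ∃ b ∈ T, b.src = a.src := ⟨a, ha, rfl⟩
  rw [outArc, dif_pos h, hT.eq_of_src_eq h.choose_spec.1 ha h.choose_spec.2]

theorem firstAttempt_eq {G : Graph α β} (T : Fin k → Set (Arc α β)) (R : Fin k → List (Arc α β))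
    {a : Arc α β} (ha : a ∈ arcs G) (m : Mode) (H : Bool) :
    firstAttempt G T R a.tgt (some a.edge) (encode m H) =
      mkAttempt T m (treeIndex T m H a) (nextArc T R m a (treeIndex T m H a)) := by
  have hu : ∃ u, G.IsLink a.edge u a.tgt := ⟨a.src, ha⟩
  have hsrc : hu.choose = a.src := Graph.IsLink.left_unique hu.choose_spec ha
  simp only [firstAttempt, dif_pos hu, hsrc, decodeMode_encode, decodeH_encode]

/-- The decision to use the arc `a` along `T i` in mode `m`. -/
noncomputable def decision (T : Fin k → Set (Arc α β)) (m : Mode) (i : Fin k) (a : Arc α β) :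
    Attempt α β :=
  ⟨m, hGivenTreeIndex T i a.edge, a⟩

theorem mkAttempt_some (T : Fin k → Set (Arc α β)) (m : Mode) (i : Fin k) (a : Arc α β) :
    mkAttempt T m i (some a) = some (decision T m i a) := rfl

/-- The closed walk along which a packet is routed outside canonical mode. -/
def traversalWalk (R : Fin k → List (Arc α β)) : Mode → Fin k → List (Arc α β)
  | .backtrack, j => inverseTraversal (R j)
  | _, j => R j

/-! ### Recovering the arborescence and the next arc from local information -/

namespace IsDFInput

variable {G : Graph α β} {d : α} {T : Fin k → Set (Arc α β)} {R : Fin k → List (Arc α β)}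
  (hI : IsDFInput G d T R)
include hI

omit [NeZero k] in
theorem index_unique {a : Arc α β} {i j : Fin k} (hi : a ∈ T i) (hj : a ∈ T j) : i = j := by
  by_contra h
  exact Set.disjoint_left.1 (hI.arcDisjoint i j h) hi hj

omit [NeZero k] in
theorem mem_arcs {a : Arc α β} {i : Fin k} (hi : a ∈ T i) : a ∈ arcs G :=
  (hI.arborescence i).subset_arcs hi

theorem treeIndexOfArc_eq {a : Arc α β} {i : Fin k} (hi : a ∈ T i) : treeIndexOfArc T a = i := by
  have h : ∃ i, a ∈ T i := ⟨i, hi⟩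
  rw [treeIndexOfArc, dif_pos h]
  exact hI.index_unique h.choose_spec hi

omit [NeZero k] in
theorem treeIndices_eq_pair {a : Arc α β} {i j : Fin k} (hi : a ∈ T i) (hj : a.rev ∈ T j) :
    treeIndices T a.edge = {i, j} := by
  ext l
  simp only [mem_treeIndices, Finset.mem_insert, Finset.mem_singleton]
  constructor
  · rintro ⟨b, hb, hba⟩
    rcases eq_or_eq_rev_of_edge_eq (hI.mem_arcs hb) (hI.mem_arcs hi) hba with rfl | rfl
    · exact .inl (hI.index_unique hb hi)
    · exact .inr (hI.index_unique hb hj)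
  · rintro (rfl | rfl)
    · exact ⟨a, hi, rfl⟩
    · exact ⟨a.rev, hj, rfl⟩

omit [NeZero k] in
theorem treeIndices_eq_singleton {a : Arc α β} {i : Fin k} (hi : a ∈ T i)
    (h : ∀ j, a.rev ∉ T j) : treeIndices T a.edge = {i, i} := by
  ext l
  simp only [mem_treeIndices, Finset.mem_insert, Finset.mem_singleton, or_self]
  constructor
  · rintro ⟨b, hb, hba⟩
    rcases eq_or_eq_rev_of_edge_eq (hI.mem_arcs hb) (hI.mem_arcs hi) hba with rfl | rfl
    · exact hI.index_unique hb hi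
    · exact absurd hb (h l)
  · rintro rfl
    exact ⟨a, hi, rfl⟩

/-- Each of the two arcs on an edge lies in at most one arborescence, so one bit suffices for the
next vertex to recover `i`. -/
theorem treeIndexGivenH_hGivenTreeIndex {a : Arc α β} {i : Fin k} (hi : a ∈ T i ∨ a.rev ∈ T i) :
    treeIndexGivenH T (hGivenTreeIndex T i a.edge) a.edge = i := by
  wlog h : a ∈ T i generalizing a
  · exact this (a := a.rev) hi.symm (hi.resolve_left h)
  by_cases hj : ∃ j, a.rev ∈ T j
  · obtain ⟨j, hj⟩ := hj
    exact treeIndexGivenH_hGivenTreeIndex_left (hI.treeIndices_eq_pair h hj)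
  · exact treeIndexGivenH_hGivenTreeIndex_left
      (hI.treeIndices_eq_singleton h (not_exists.1 hj))

theorem treeIndex_decision {m : Mode} (hm : m ≠ .canonical) {a : Arc α β} {i : Fin k}
    (hi : a ∈ T i ∨ a.rev ∈ T i) : treeIndex T m (hGivenTreeIndex T i a.edge) a = i := by
  cases m with
  | canonical => exact absurd rfl hm
  | traverse => exact hI.treeIndexGivenH_hGivenTreeIndex hi
  | backtrack => exact hI.treeIndexGivenH_hGivenTreeIndex hi

omit [NeZero k] in
theorem mem_or_rev_mem {m : Mode} {j : Fin k} {a : Arc α β} (ha : a ∈ traversalWalk R m j) :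
    a ∈ T j ∨ a.rev ∈ T j := by
  cases m with
  | backtrack => exact ((hI.traversal j).mem_or_rev_mem (mem_inverseTraversal.1 ha)).symm
  | canonical => exact (hI.traversal j).mem_or_rev_mem ha
  | traverse => exact (hI.traversal j).mem_or_rev_mem ha

omit [NeZero k] in
theorem nodup_traversalWalk (m : Mode) (j : Fin k) : (traversalWalk R m j).Nodup := by
  have h := (hI.traversal j).nodup (hI.arborescence j)
  cases m with
  | backtrack => exact List.nodup_reverse.2 (h.map Arc.rev_injective)
  | canonical => exact h
  | traverse => exact h

omit [NeZero k] in
theorem isWalk_traversalWalk (m : Mode) (j : Fin k) :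
    IsWalk (arcs G) d (traversalWalk R m j) d := by
  have h := (hI.traversal j).isWalk (hI.arborescence j)
  cases m with
  | backtrack => exact h.inverseTraversal
  | canonical => exact h
  | traverse => exact h

omit [NeZero k] in
theorem nextArc_eq {m : Mode} (hm : m ≠ .canonical) {j : Fin k} {a b : Arc α β}
    {l₁ l₂ : List (Arc α β)} (h : traversalWalk R m j = l₁ ++ a :: b :: l₂) :
    nextArc T R m a j = some b := by
  have hnd := hI.nodup_traversalWalk m j
  have hnext : nextArc T R m a j = nextArcIn a (traversalWalk R m j) := by
    cases m with
    | canonical => exact absurd rfl hm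
    | traverse => rfl
    | backtrack => rfl
  rw [h] at hnd
  rw [hnext, h, nextArcIn_append]
  exact fun ha => (List.nodup_append.1 hnd).2.2 a ha a List.mem_cons_self rfl

/-! ### Success of bouncing, backtracking and switching -/

variable {F : Set β}

/-- Routing along active edges of a traversal, or of an inverse traversal, from the arc following
`c` up to the arc `b`. -/
theorem exists_succeeds_of_follow {m : Mode} (hm : m ≠ .canonical) {j : Fin k} {b : Arc α β}
    {l₂ : List (Arc α β)} (hb : Succeeds G d T R F (decision T m j b)) :
    ∀ (p l₁ : List (Arc α β)) (c : Arc α β),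
      traversalWalk R m j = l₁ ++ c :: (p ++ b :: l₂) → (∀ a ∈ p, a.edge ∉ F) →
      ∃ x, nextArc T R m c j = some x ∧ x.src = c.tgt ∧
        Succeeds G d T R F (decision T m j x) := by
  intro p
  induction p with
  | nil =>
    intro l₁ c h _
    exact ⟨b, hI.nextArc_eq hm h, (h ▸ hI.isWalk_traversalWalk m j).src_eq_tgt, hb⟩
  | cons y p ih =>
    intro l₁ c h hp
    obtain ⟨x, hx, hxsrc, hxs⟩ := ih (l₁ ++ [c]) y (by simpa using h)
      fun a ha => hp a (List.mem_cons_of_mem _ ha)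
    have hyR : y ∈ traversalWalk R m j := by simp [h]
    have hyG : y ∈ arcs G := (hI.isWalk_traversalWalk m j).mem y hyR
    have hyF := hp y List.mem_cons_self
    refine ⟨y, hI.nextArc_eq hm h, (h ▸ hI.isWalk_traversalWalk m j).src_eq_tgt, ?_⟩
    -- The traversal may pass through `d` before reaching `b`; the packet then stops there.
    by_cases hyd : y.tgt = d
    · exact .arrive hyG hyF hyd
    · refine .hop (t := decision T m j y) (t' := decision T m j x) hyG hyF hyd ?_ hxsrc hxs
      rw [decision, firstAttempt_eq T R hyG, hI.treeIndex_decision hm (hI.mem_or_rev_mem hyR), hx,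
        mkAttempt_some]

theorem retry_canonical {a : Arc α β} {i j : Fin k} (hi : a ∈ T i) (hj : a.rev ∈ T j) :
    retry T R (decision T .canonical i a) =
      mkAttempt T .traverse j (nextArc T R .traverse a.rev j) := by
  have hij : j ≠ i := fun h => (hI.arborescence i).rev_notMem hi (h ▸ hj)
  simp only [retry, decision, treeIndex, hI.treeIndexOfArc_eq hi,
    treeIndexGivenH_not_hGivenTreeIndex (hI.treeIndices_eq_pair hi hj)]
  rw [if_pos hij]

theorem retry_canonical_of_unshared {a : Arc α β} {i : Fin k} (hi : a ∈ T i)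
    (hj : ∀ j, a.rev ∉ T j) :
    retry T R (decision T .canonical i a) = some ⟨.backtrack, false, a⟩ := by
  simp [retry, decision, treeIndex, hI.treeIndexOfArc_eq hi,
    treeIndexGivenH_not_hGivenTreeIndex (hI.treeIndices_eq_singleton hi hj)]

theorem retry_traverse {b : Arc α β} {j : Fin k} (hb : b ∈ T j ∨ b.rev ∈ T j) :
    retry T R (decision T .traverse j b) =
      mkAttempt T .backtrack j (nextArc T R .backtrack b.rev j) := by
  simp only [retry, decision, treeIndex, hI.treeIndexGivenH_hGivenTreeIndex hb]

/-- If routing succeeds from the failed arcs of `T i`, it succeeds from all its arcs. -/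
theorem succeeds_canonical {i : Fin k}
    (h : ∀ a ∈ T i, a.edge ∈ F → Succeeds G d T R F (decision T .canonical i a)) :
    ∀ a ∈ T i, Succeeds G d T R F (decision T .canonical i a) := by
  suffices hp : ∀ p, ∀ a ∈ T i, IsWalk (T i) a.tgt p d →
      Succeeds G d T R F (decision T .canonical i a) by
    intro a ha
    obtain ⟨p, hw⟩ := (hI.arborescence i).exists_walk (tgt_mem_of_mem_arcs (hI.mem_arcs ha))
    exact hp p a ha hw
  intro p
  induction p with
  | nil =>
    intro a ha hw
    by_cases haF : a.edge ∈ F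
    · exact h a ha haF
    · exact .arrive (hI.mem_arcs ha) haF hw
  | cons b p ih =>
    intro a ha ⟨hb, hba, hw⟩
    by_cases haF : a.edge ∈ F
    · exact h a ha haF
    · refine .hop (t := decision T .canonical i a) (t' := decision T .canonical i b)
        (hI.mem_arcs ha) haF (hba ▸ (hI.arborescence i).root_out b hb) ?_ hba (ih b hb hw)
      rw [decision, firstAttempt_eq T R (hI.mem_arcs ha), treeIndex, hI.treeIndexOfArc_eq ha,
        nextArc, ← hba, outArc_eq (hI.arborescence i) hb, mkAttempt_some]

/-- Bouncing succeeds if no failed arc follows in the traversal. -/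
theorem succeeds_of_bounce {i j : Fin k} {a : Arc α β} (hi : a ∈ T i) (haF : a.edge ∈ F)
    (hj : a.rev ∈ T j) {l₁ l₂ : List (Arc α β)} (hR : R j = l₁ ++ a.rev :: l₂)
    (hl : ∀ b ∈ l₂, b.edge ∉ F) : Succeeds G d T R F (decision T .canonical i a) := by
  have hw := hI.isWalk_traversalWalk .traverse j
  rw [traversalWalk.eq_2 _ _ _ (by simp), hR] at hw
  -- The traversal ends at `d`. It cannot end with `a.rev`, since no arc of `T i` leaves `d`; so its
  -- last arc `b` lies in `l₂` and delivers the packet.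
  rcases List.eq_nil_or_concat l₂ with rfl | ⟨p, b, rfl⟩
  · obtain ⟨v, -, -, -, h⟩ := isWalk_append.1 hw
    exact absurd h ((hI.arborescence i).root_out a hi)
  · rw [List.concat_eq_append] at hR hl hw
    have hbd : b.tgt = d := by
      obtain ⟨v, -, -, -, h⟩ := isWalk_append.1 hw
      obtain ⟨u, -, -, -, h⟩ := isWalk_append.1 h
      exact h
    have hb : Succeeds G d T R F (decision T .traverse j b) :=
      .arrive (hw.mem b (by simp)) (hl b (by simp)) hbd
    obtain ⟨x, hx, hxsrc, hxs⟩ := hI.exists_succeeds_of_follow (by simp) hb p l₁ a.rev hR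
      fun c hc => hl c (by simp [hc])
    refine .retry (t := decision T .canonical i a) haF ?_ hxsrc hxs
    rw [hI.retry_canonical hi hj, hx, mkAttempt_some]

/-- Back at the arc on which the packet bounced, the next arborescence is used. -/
theorem succeeds_backtrack_of_next {i : Fin k}
    (hnext : ∀ b ∈ T (i + 1), Succeeds G d T R F (decision T .canonical (i + 1) b))
    {a : Arc α β} (hi : a ∈ T i) (haF : a.edge ∈ F) (H : Bool) :
    Succeeds G d T R F ⟨.backtrack, H, a⟩ := by
  obtain ⟨b, hb, hba⟩ := (hI.arborescence (i + 1)).exists_out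
    (src_mem_of_mem_arcs (hI.mem_arcs hi)) ((hI.arborescence i).root_out a hi)
  -- After backtracking, `H` refers to the arborescence whose traversal was retraced. The index `i`
  -- is read off from `a` itself, so `H` is arbitrary.
  refine .retry haF ?_ hba (hnext b hb)
  simp only [retry, treeIndex, hI.treeIndexOfArc_eq hi, ← hba,
    outArc_eq (hI.arborescence (i + 1)) hb, mkAttempt_some]

theorem succeeds_canonical_of_next {i : Fin k}
    (hnext : ∀ b ∈ T (i + 1), Succeeds G d T R F (decision T .canonical (i + 1) b)) :
    ∀ a ∈ T i, Succeeds G d T R F (decision T .canonical i a) := by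
  refine hI.succeeds_canonical fun a ha haF => ?_
  by_cases hj : ∃ j, a.rev ∈ T j
  · obtain ⟨j, hj⟩ := hj
    obtain ⟨l₁, l₂, hR⟩ := List.append_of_mem ((hI.traversal j).mem (hI.arborescence j) hj)
    by_cases hl : ∃ b ∈ l₂, b.edge ∈ F
    · obtain ⟨p, b, l₃, rfl, hbF, hp⟩ :=
        exists_eq_append_cons_of_first (P := fun b : Arc α β => b.edge ∈ F) hl
      -- Here `b` is the first failed arc after `a.rev`. Reversing the walk retraces the active
      -- segment `p` and then proposes `a`, so the packet is back where it bounced.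
      have hinv : traversalWalk R .backtrack j =
          inverseTraversal l₃ ++ b.rev :: (inverseTraversal p ++ a :: inverseTraversal l₁) := by
        simp [traversalWalk, hR, inverseTraversal_append, inverseTraversal_cons]
      obtain ⟨x, hx, hxsrc, hxs⟩ := hI.exists_succeeds_of_follow (by simp)
        (hI.succeeds_backtrack_of_next hnext ha haF _) (inverseTraversal p) _ _ hinv
        fun c hc => hp c.rev (mem_inverseTraversal.1 hc)
      have hb : Succeeds G d T R F (decision T .traverse j b) := by
        refine .retry (t := decision T .traverse j b) hbF ?_ hxsrc hxs
        rw [hI.retry_traverse ((hI.traversal j).mem_or_rev_mem (by simp [hR])), hx,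
          mkAttempt_some]
      obtain ⟨y, hy, hysrc, hys⟩ := hI.exists_succeeds_of_follow (by simp) hb p l₁ a.rev hR hp
      refine .retry (t := decision T .canonical i a) haF ?_ hysrc hys
      rw [hI.retry_canonical ha hj, hy, mkAttempt_some]
    · push Not at hl
      exact hI.succeeds_of_bounce ha haF hj hR hl
  · exact .retry (t := decision T .canonical i a) haF
      (hI.retry_canonical_of_unshared ha (not_exists.1 hj)) rfl
      (hI.succeeds_backtrack_of_next hnext ha haF _)

/-- If fewer than `k` edges fail, bouncing succeeds from all failed arcs of some arborescence. -/
theorem exists_good_index (hF : F.encard ≤ (k - 1 : ℕ)) :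
    ∃ g, ∀ a ∈ T g, a.edge ∈ F → ∃ j l₁ l₂, a.rev ∈ T j ∧ R j = l₁ ++ a.rev :: l₂ ∧
      ∀ b ∈ l₂, b.edge ∉ F := by
  by_contra! hbad
  choose bad hbadT hbadF hbad using hbad
  have hlast := fun j => (hI.traversal j).exists_last_failed (hI.arborescence j)
    ⟨bad j, hbadT j, hbadF j⟩
  choose l₁ last l₂ hR hlastT hlastF hl₂ using hlast
  have hFfin : F.Finite := Set.finite_of_encard_le_coe hF
  -- These are the `2 * k` distinct arcs on failed edges.
  set φ : Fin k ⊕ Fin k → Arc α β := Sum.elim bad fun j => (last j).rev with hφ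
  have hne : ∀ i j, bad i ≠ (last j).rev := fun i j h => by
    obtain ⟨b, hb, hbF⟩ := hbad i j (l₁ j) (l₂ j) (by rw [h]; exact hlastT j)
      (by rw [h]; exact hR j)
    exact hl₂ j b hb hbF
  have hinj : Function.Injective φ := by
    refine Function.Injective.sumElim (fun i j h => hI.index_unique (hbadT i) (h ▸ hbadT j))
      (fun i j h => ?_) hne
    exact hI.index_unique (hlastT i) (Arc.rev_injective h ▸ hlastT j)
  have hφG : ∀ x, φ x ∈ arcs G := by
    rintro (i | j)
    · exact hI.mem_arcs (hbadT i)
    · exact rev_mem_arcs (hI.mem_arcs (hlastT j))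
  have hφF : ∀ x, (φ x).edge ∈ F := by
    rintro (i | j)
    · exact hbadF i
    · exact hlastF j
  have h1 : (Finset.univ.image φ).card = k + k := by
    rw [Finset.card_image_of_injective _ hinj, Finset.card_univ, Fintype.card_sum,
      Fintype.card_fin]
  have h2 : (Finset.univ.image φ).card ≤ 2 * ((Finset.univ.image φ).image Arc.edge).card := by
    refine Finset.card_le_mul_card_image _ 2 fun e he => ?_
    obtain ⟨b, hb, rfl⟩ := Finset.mem_image.1 he
    obtain ⟨y, -, rfl⟩ := Finset.mem_image.1 hb
    refine (Finset.card_le_card (t := {φ y, (φ y).rev}) fun a ha => ?_).trans Finset.card_le_two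
    obtain ⟨ha, hae⟩ := Finset.mem_filter.1 ha
    obtain ⟨x, -, rfl⟩ := Finset.mem_image.1 ha
    simpa using eq_or_eq_rev_of_edge_eq (hφG x) (hφG y) hae
  have h3 : ((Finset.univ.image φ).image Arc.edge).card ≤ hFfin.toFinset.card := by
    refine Finset.card_le_card fun e he => ?_
    obtain ⟨b, hb, rfl⟩ := Finset.mem_image.1 he
    obtain ⟨x, -, rfl⟩ := Finset.mem_image.1 hb
    exact hFfin.mem_toFinset.2 (hφF x)
  have h4 : hFfin.toFinset.card ≤ k - 1 := by
    rw [hFfin.encard_eq_coe_toFinset_card] at hF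
    exact_mod_cast hF
  -- With truncated subtraction, `2 * k ≤ 2 * (k - 1)` is absurd only for positive `k`.
  have := NeZero.pos k
  omega

theorem succeeds_canonical_of_encard_le (hF : F.encard ≤ (k - 1 : ℕ)) :
    ∀ a ∈ T 0, Succeeds G d T R F (decision T .canonical 0 a) := by
  obtain ⟨g, hg⟩ := hI.exists_good_index hF
  -- Induction on the distance from `i` up to the good index `g`; since `i < g` in the successor
  -- step, `i + 1` does not wrap around.
  suffices h : ∀ n, ∀ i : Fin k, i.val + n = g.val →
      ∀ a ∈ T i, Succeeds G d T R F (decision T .canonical i a) from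
    h g.val 0 (by simp)
  intro n
  induction n with
  | zero =>
    intro i hi
    obtain rfl : i = g := Fin.ext hi
    refine hI.succeeds_canonical fun a ha haF => ?_
    obtain ⟨j, l₁, l₂, hj, hR, hl⟩ := hg a ha haF
    exact hI.succeeds_of_bounce ha haF hj hR hl
  | succ n ih =>
    intro i hi
    refine hI.succeeds_canonical_of_next (ih (i + 1) ?_)
    have hval : (i + 1).val = i.val + 1 := by
      have := g.isLt
      rw [Fin.val_add, Fin.val_one', Nat.add_mod_mod, Nat.mod_eq_of_lt (by omega)]
    omega

theorem isResilient : IsResilient G d (dfAlgo G T R) (k - 1) := by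
  intro F _ hF v hv _
  by_cases hvd : v = d
  · exact ⟨_, hvd, .refl⟩
  · obtain ⟨a, ha, rfl⟩ := (hI.arborescence 0).exists_out hv hvd
    refine (hI.succeeds_canonical_of_encard_le hF a ha).exists_reflTransGen none _ 0 hvd ?_
      fun m hm => absurd hm (Nat.not_lt_zero m)
    change mkAttempt T .canonical 0 (outArc (T 0) a.src) = _
    rw [outArc_eq (hI.arborescence 0) ha, mkAttempt_some]

end IsDFInput

end Algorithm

end FailoverRouting

theorem mainTheorem5 {α β : Type*} (G : Graph α β) (hV : G.vertexSet.Finite)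
    (hE : G.edgeSet.Finite) (k : ℕ) [NeZero k] (hG : IsEdgeConnected G k)
    (d : α) (hd : d ∈ G.vertexSet) :
    (∃ (T : Fin k → Set (Arc α β)) (R : Fin k → List (Arc α β)), IsDFInput G d T R) ∧
      ∀ (T : Fin k → Set (Arc α β)) (R : Fin k → List (Arc α β)), IsDFInput G d T R →
        IsResilient G d (dfAlgo G T R) (k - 1) := by
  exact ⟨hG.exists_isDFInput hV hE hd, fun _ _ hI => hI.isResilient⟩
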